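/- For integers $n\ge 0$ and $0\le m\le 2^n$ let Stern's diatomic integers $[2^n:m]$ be given by $[2^0:0]=0$, $[2^0:1]=1$, $[2^{n+1}:2m]=[2^n:m]$ for $0\le m\le 2^n$, and $[2^{n+1}:2m+1]=[2^n:m]+[2^n:m+1]$ for $0\le m\le 2^n-1$. Let $S=\{m/2^n : m,n\in\mathbb Z_{\ge 0},\ 0\le m\le 2^n-1\}$, and let the assembly function $\mathcal A:[0,1)\to[0,\infty)$ be the unique continuous function with $\mathcal A(m/2^n)=[2^n:m]/[2^n:2^n-m]$ for all $m/2^n\in S$. A finite design is a finite word $d_1d_2\cdots d_n$ ($n\ge 0$) in the letters $0,1$; its design decimal is $0.d_1d_2\cdots d_n=\sum_{i=1}^n d_i2^{-i}$. An infinite design is an infinite word $1^{k_0}0^{k_1}1^{k_2}0^{k_3}\cdots$ with integers $k_0\ge 0$ and $k_j\ge 1$ for $j\ge 1$; its design decimal is the limit, as $j\to\infty$, of the design decimals of $1^{k_0}0^{k_1}\cdots 0^{k_{2j-1}}1^{k_{2j}}$. An infinite design $D$ is periodic if $D=D'PPP\cdots$ for some finite designs $D'$ and $P$ with $P$ not empty.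 A quadratic irrational number is an irrational real root of a quadratic polynomial with integer coefficients. **Theorem.** Let $\theta\in[0,1)$ and $\omega=\mathcal A(\theta)$. 1. $\omega$ is a rational number if and only if $\theta\in S$, i.e. $\theta=m/2^n$ for some integers $n\ge 0$ and $0\le m\le 2^n-1$; equivalently, if and only if $\theta$ is the design decimal of a finite design. 2. $\omega$ is a quadratic irrational number if and only if $\theta$ is a rational number not in $S$; equivalently, if and only if $\theta$ is the design decimal of a periodic infinite design. -/

import Mathlib

open Filter Topology Set

/-- Stern's diatomic integer `[2^n : m]`, with depth `n` and order `m`. It is meant for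
`0 ≤ m ≤ 2 ^ n` only: `[2^0:0] = 0`, `[2^0:1] = 1`, `[2^(n+1):2m] = [2^n:m]`,
`[2^(n+1):2m+1] = [2^n:m] + [2^n:m+1]`. -/
def sternInt : ℕ → ℕ → ℕ
  | 0, m => m
  | n + 1, m =>
    if m % 2 = 0 then sternInt n (m / 2) else sternInt n (m / 2) + sternInt n (m / 2 + 1)

/-- The value `[2^n : m] / [2^n : 2^n - m]` of the rational assembly function at `m / 2^n`,
for `0 ≤ m < 2 ^ n` (the denominator is then positive). -/
noncomputable def ratAssembly (n m : ℕ) : ℝ :=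
  (sternInt n m : ℝ) / (sternInt n (2 ^ n - m) : ℝ)

/-- The set `S` of the dyadic rationals `m / 2^n` with `0 ≤ m ≤ 2^n - 1`. -/
def dyadicSet : Set ℝ :=
  {θ | ∃ n m : ℕ, m < 2 ^ n ∧ θ = (m : ℝ) / 2 ^ n}

/-- The assembly function on `[0, 1)`: the completion of the (increasing) rational assembly
function. That this is the unique continuous extension to `[0, 1)` of the rational assembly
function is proved in `assembly_dyadic`, `assembly_continuousOn` and `assembly_unique`. -/
noncomputable def assembly (θ : ℝ) : ℝ :=
  sSup {x : ℝ | ∃ n m : ℕ, m < 2 ^ n ∧ (m : ℝ) / 2 ^ n ≤ θ ∧ x = ratAssembly n m}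

theorem sternInt_even (n m : ℕ) : sternInt (n + 1) (2 * m) = sternInt n m := by
  simp [sternInt]

theorem sternInt_odd (n m : ℕ) :
    sternInt (n + 1) (2 * m + 1) = sternInt n m + sternInt n (m + 1) := by
  have h : (2 * m + 1) / 2 = m := by omega
  have h2 : (2 * m + 1) % 2 = 1 := by omega
  simp [sternInt, h, h2]

theorem sternInt_pos (n m : ℕ) (h : 0 < m) : 0 < sternInt n m := by
  induction n generalizing m with
  | zero => simpa [sternInt] using h
  | succ n ih =>
    obtain ⟨k, rfl | rfl⟩ := Nat.even_or_odd' m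
    · rw [sternInt_even]; exact ih k (by omega)
    · rw [sternInt_odd]; have := ih (k + 1) (by omega); omega

theorem sternInt_left (n m : ℕ) (h : m ≤ 2 ^ n) : sternInt (n + 1) m = sternInt n m := by
  induction n generalizing m with
  | zero =>
    have : m = 0 ∨ m = 1 := by simp at h; omega
    rcases this with rfl | rfl <;> simp [sternInt]
  | succ n ih =>
    rw [pow_succ] at h
    obtain ⟨k, rfl | rfl⟩ := Nat.even_or_odd' m
    · rw [sternInt_even, sternInt_even, ih k (by omega)]
    · rw [sternInt_odd, sternInt_odd, ih k (by omega), ih (k + 1) (by omega)]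

theorem sternInt_right (n m m' : ℕ) (h : m + m' = 2 ^ n) :
    sternInt (n + 1) (2 ^ n + m) = sternInt n m + sternInt n m' := by
  induction n generalizing m m' with
  | zero =>
    have : (m = 0 ∧ m' = 1) ∨ (m = 1 ∧ m' = 0) := by simp at h; omega
    rcases this with ⟨rfl, rfl⟩ | ⟨rfl, rfl⟩ <;> simp [sternInt]
  | succ n ih =>
    rw [pow_succ] at h ⊢
    obtain ⟨k, rfl | rfl⟩ := Nat.even_or_odd' m
    · obtain ⟨k', rfl⟩ : ∃ k', m' = 2 * k' := ⟨m' / 2, by omega⟩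
      rw [show 2 ^ n * 2 + 2 * k = 2 * (2 ^ n + k) by ring, sternInt_even, sternInt_even,
        sternInt_even, ih k k' (by omega)]
    · obtain ⟨k', rfl⟩ : ∃ k', m' = 2 * k' + 1 := ⟨m' / 2, by omega⟩
      rw [show 2 ^ n * 2 + (2 * k + 1) = 2 * (2 ^ n + k) + 1 by ring, sternInt_odd, sternInt_odd,
        sternInt_odd, ih k (k' + 1) (by omega), add_assoc (2 ^ n), ih (k + 1) k' (by omega)]
      ring

theorem sternInt_det (n m m' : ℕ) (h : m + m' + 1 = 2 ^ n) :
    sternInt n (m + 1) * sternInt n (m' + 1) = sternInt n m * sternInt n m' + 1 := by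
  induction n generalizing m m' with
  | zero =>
    have : m = 0 ∧ m' = 0 := by simp at h; omega
    obtain ⟨rfl, rfl⟩ := this
    simp [sternInt]
  | succ n ih =>
    rw [pow_succ] at h
    obtain ⟨k, rfl | rfl⟩ := Nat.even_or_odd' m
    · obtain ⟨k', rfl⟩ : ∃ k', m' = 2 * k' + 1 := ⟨m' / 2, by omega⟩
      rw [show 2 * k' + 1 + 1 = 2 * (k' + 1) by ring, sternInt_odd, sternInt_even, sternInt_even,
        sternInt_odd]
      linarith [ih k k' (by omega)]
    · obtain ⟨k', rfl⟩ : ∃ k', m' = 2 * k' := ⟨m' / 2, by omega⟩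
      rw [show 2 * k + 1 + 1 = 2 * (k + 1) by ring, sternInt_odd, sternInt_even, sternInt_even,
        sternInt_odd]
      linarith [ih k k' (by omega)]

theorem ratAssembly_nonneg (n m : ℕ) : 0 ≤ ratAssembly n m := by
  unfold ratAssembly; positivity

theorem ratAssembly_step (n m : ℕ) (h : m + 1 < 2 ^ n) :
    ratAssembly n m ≤ ratAssembly n (m + 1) := by
  obtain ⟨m', hm'⟩ : ∃ m', m + m' + 1 = 2 ^ n := ⟨2 ^ n - m - 1, by omega⟩
  have hd := sternInt_det n m m' hm'
  have e1 : 2 ^ n - m = m' + 1 := by omega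
  have e2 : 2 ^ n - (m + 1) = m' := by omega
  have p1 := sternInt_pos n (m' + 1) (by omega)
  have p2 := sternInt_pos n m' (by omega)
  unfold ratAssembly
  rw [e1, e2, div_le_div_iff₀ (by exact_mod_cast p1) (by exact_mod_cast p2)]
  exact_mod_cast (by omega : sternInt n m * sternInt n m' ≤
    sternInt n (m + 1) * sternInt n (m' + 1))

theorem ratAssembly_mono (n m m' : ℕ) (h : m ≤ m') (h' : m' < 2 ^ n) :
    ratAssembly n m ≤ ratAssembly n m' := by
  induction m', h using Nat.le_induction with
  | base => exact le_rfl
  | succ k hk ih => exact (ih (by omega)).trans (ratAssembly_step n k h')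

theorem ratAssembly_refine (n m k : ℕ) :
    ratAssembly (n + k) (2 ^ k * m) = ratAssembly n m := by
  induction k with
  | zero => simp
  | succ k ih =>
    rw [← ih]
    unfold ratAssembly
    rw [← add_assoc, show 2 ^ (k + 1) * m = 2 * (2 ^ k * m) by ring, sternInt_even,
      show 2 ^ (n + k + 1) - 2 * (2 ^ k * m) = 2 * (2 ^ (n + k) - 2 ^ k * m) by
        rw [pow_succ]; omega, sternInt_even]

theorem ratAssembly_le (n m n' m' : ℕ) (h' : m' < 2 ^ n')
    (h : (m : ℝ) / 2 ^ n ≤ (m' : ℝ) / 2 ^ n') : ratAssembly n m ≤ ratAssembly n' m' := by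
  rw [div_le_div_iff₀ (by positivity) (by positivity)] at h
  have h2 : m * 2 ^ n' ≤ m' * 2 ^ n := by exact_mod_cast h
  rw [← ratAssembly_refine n m n', ← ratAssembly_refine n' m' n, add_comm n' n]
  refine ratAssembly_mono _ _ _ (by linarith) ?_
  rw [pow_add]
  exact Nat.mul_lt_mul_of_pos_left h' (by positivity)

theorem ratAssembly_low (n m : ℕ) (h : m < 2 ^ n) :
    ratAssembly (n + 1) m = ratAssembly n m / (1 + ratAssembly n m) := by
  have p := sternInt_pos n (2 ^ n - m) (by omega)
  have p' : (0 : ℝ) < sternInt n (2 ^ n - m) := by exact_mod_cast p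
  have e : 2 ^ (n + 1) - m = 2 ^ n + (2 ^ n - m) := by rw [pow_succ]; omega
  unfold ratAssembly
  rw [e, sternInt_left n m h.le, sternInt_right n (2 ^ n - m) m (by omega)]
  push_cast
  have : (0 : ℝ) ≤ sternInt n m := by positivity
  field_simp

theorem ratAssembly_high (n m : ℕ) (h : m < 2 ^ n) :
    ratAssembly (n + 1) (2 ^ n + m) = 1 + ratAssembly n m := by
  have p := sternInt_pos n (2 ^ n - m) (by omega)
  have p' : (0 : ℝ) < sternInt n (2 ^ n - m) := by exact_mod_cast p
  have e : 2 ^ (n + 1) - (2 ^ n + m) = 2 ^ n - m := by rw [pow_succ]; omega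
  unfold ratAssembly
  rw [e, sternInt_left n (2 ^ n - m) (by omega), sternInt_right n m (2 ^ n - m) (by omega)]
  push_cast
  field_simp
  ring

theorem ratAssembly_surj (s a b : ℕ) (hs : a + b ≤ s) (hb : 0 < b) :
    ∃ n m : ℕ, m < 2 ^ n ∧ ratAssembly n m = (a : ℝ) / b := by
  induction s generalizing a b with
  | zero => omega
  | succ s ih =>
    have hb' : (0 : ℝ) < b := by exact_mod_cast hb
    rcases Nat.eq_zero_or_pos a with rfl | ha
    · exact ⟨0, 0, by simp, by simp [ratAssembly, sternInt]⟩
    · rcases Nat.lt_or_ge a b with hab | hab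
      · obtain ⟨c, rfl⟩ := Nat.exists_eq_add_of_lt hab
        obtain ⟨n, m, hm, he⟩ := ih a (c + 1) (by omega) (by omega)
        refine ⟨n + 1, m, by rw [pow_succ]; omega, ?_⟩
        rw [ratAssembly_low n m hm, he]
        push_cast
        field_simp
        ring
      · obtain ⟨c, rfl⟩ := Nat.exists_eq_add_of_le hab
        obtain ⟨n, m, hm, he⟩ := ih c b (by omega) hb
        refine ⟨n + 1, 2 ^ n + m, by rw [pow_succ]; omega, ?_⟩
        rw [ratAssembly_high n m hm, he]
        push_cast
        field_simp

/-- The assembly function extends the rational assembly function. -/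
theorem assembly_dyadic (n m : ℕ) (h : m < 2 ^ n) :
    assembly ((m : ℝ) / 2 ^ n) = ratAssembly n m := by
  refine IsGreatest.csSup_eq ⟨⟨n, m, h, le_rfl, rfl⟩, ?_⟩
  rintro x ⟨n', m', -, hle, rfl⟩
  exact ratAssembly_le _ _ _ _ h hle

theorem dyadicSet_between (x y : ℝ) (hx : 0 ≤ x) (hxy : x < y) (hy : y ≤ 1) :
    ∃ n m : ℕ, m < 2 ^ n ∧ x < (m : ℝ) / 2 ^ n ∧ (m : ℝ) / 2 ^ n < y := by
  obtain ⟨n, hn⟩ := exists_pow_lt_of_lt_one (sub_pos.2 hxy) (by norm_num : (1 / 2 : ℝ) < 1)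
  have hp : (0 : ℝ) < 2 ^ n := by positivity
  have hn' : 1 < (y - x) * 2 ^ n := by
    rw [one_div, inv_pow, inv_lt_iff_one_lt_mul₀ hp] at hn
    linarith
  have h1 := Nat.lt_floor_add_one (x * 2 ^ n)
  have h2 := Nat.floor_le (by positivity : 0 ≤ x * 2 ^ n)
  have h3 : ((⌊x * 2 ^ n⌋₊ + 1 : ℕ) : ℝ) < y * 2 ^ n := by push_cast; nlinarith
  refine ⟨n, ⌊x * 2 ^ n⌋₊ + 1, ?_, ?_, ?_⟩
  · have : ((⌊x * 2 ^ n⌋₊ + 1 : ℕ) : ℝ) < 2 ^ n := by nlinarith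
    exact_mod_cast this
  · rw [lt_div_iff₀ hp]; push_cast; exact h1
  · rw [div_lt_iff₀ hp]; exact h3

theorem assembly_monotoneOn : MonotoneOn assembly (Ico 0 1) := by
  intro x hx y hy hxy
  obtain ⟨n, m, hm, hlt, -⟩ := dyadicSet_between y 1 hy.1 hy.2 le_rfl
  refine csSup_le_csSup ⟨ratAssembly n m, ?_⟩ ⟨0, 0, 0, by simp, by simpa using hx.1, ?_⟩ ?_
  · rintro z ⟨n', m', -, hle, rfl⟩
    exact ratAssembly_le _ _ _ _ hm (hle.trans hlt.le)
  · simp [ratAssembly, sternInt]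
  · rintro z ⟨n', m', h', hle, rfl⟩
    exact ⟨n', m', h', hle.trans hxy, rfl⟩

theorem assembly_nonneg (θ : ℝ) : 0 ≤ assembly θ := by
  refine Real.sSup_nonneg ?_
  rintro x ⟨n, m, -, -, rfl⟩
  exact ratAssembly_nonneg n m

theorem assembly_rat (q : ℚ) (hq : 0 ≤ q) : ∃ t ∈ Ico (0 : ℝ) 1, assembly t = q := by
  obtain ⟨n, m, hm, he⟩ := ratAssembly_surj _ q.num.toNat q.den le_rfl q.den_pos
  refine ⟨(m : ℝ) / 2 ^ n, ⟨by positivity, ?_⟩, ?_⟩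
  · rw [div_lt_one (by positivity)]; exact_mod_cast hm
  · rw [assembly_dyadic n m hm, he]
    have h1 : ((q.num.toNat : ℤ) : ℝ) = q.num := by
      rw [Int.toNat_of_nonneg (Rat.num_nonneg.2 hq)]
    rw [Rat.cast_def, ← h1, Int.cast_natCast]

/-- The assembly function is continuous on `[0, 1)`. -/
theorem assembly_continuousOn : ContinuousOn assembly (Ico 0 1) := by
  intro x hx
  refine tendsto_order.2 ⟨fun a ha => ?_, fun b hb => ?_⟩
  · rcases lt_or_ge a 0 with h0 | h0
    · exact Eventually.of_forall fun y => h0.trans_le (assembly_nonneg y)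
    · obtain ⟨q, hq1, hq2⟩ := exists_rat_btwn ha
      obtain ⟨t, ht, he⟩ := assembly_rat q (by exact_mod_cast h0.trans hq1.le)
      have htx : t < x := by
        by_contra! hc
        have := assembly_monotoneOn hx ht hc
        linarith
      filter_upwards [self_mem_nhdsWithin, mem_nhdsWithin_of_mem_nhds (Ioi_mem_nhds htx)]
        with y hy hty
      have := assembly_monotoneOn ht hy (le_of_lt hty)
      linarith
  · obtain ⟨q, hq1, hq2⟩ := exists_rat_btwn hb
    obtain ⟨t, ht, he⟩ := assembly_rat q
      (by exact_mod_cast (assembly_nonneg x).trans hq1.le)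
    have htx : x < t := by
      by_contra! hc
      have := assembly_monotoneOn ht hx hc
      linarith
    filter_upwards [self_mem_nhdsWithin, mem_nhdsWithin_of_mem_nhds (Iio_mem_nhds htx)]
      with y hy hty
    have := assembly_monotoneOn hy ht (le_of_lt hty)
    linarith

/-- The assembly function is the only continuous extension of the rational one to `[0, 1)`. -/
theorem assembly_unique (f : ℝ → ℝ) (hf : ContinuousOn f (Ico 0 1))
    (hd : ∀ n m : ℕ, m < 2 ^ n → f ((m : ℝ) / 2 ^ n) = ratAssembly n m) :
    EqOn f assembly (Ico 0 1) := by
  have hsub : dyadicSet ⊆ Ico 0 1 := by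
    rintro _ ⟨n, m, hm, rfl⟩
    refine ⟨by positivity, ?_⟩
    rw [div_lt_one (by positivity)]; exact_mod_cast hm
  refine EqOn.of_subset_closure (s := dyadicSet) ?_ hf assembly_continuousOn hsub ?_
  · rintro _ ⟨n, m, hm, rfl⟩
    rw [hd n m hm, assembly_dyadic n m hm]
  · intro x hx
    refine Metric.mem_closure_iff.2 fun ε hε => ?_
    obtain ⟨n, m, hm, h1, h2⟩ := dyadicSet_between x (min 1 (x + ε)) hx.1
      (lt_min hx.2 (by linarith)) (min_le_left _ _)
    refine ⟨_, ⟨n, m, hm, rfl⟩, ?_⟩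
    rw [Real.dist_eq, abs_lt]
    have := h2.trans_le (min_le_right _ _)
    constructor <;> linarith

/-- The number `m = ∑ 2^(n-i) d_i` of a finite dyadic word `d_1 d_2 ⋯ d_n`
(`true` is the letter `1`, `false` the letter `0`), read as a binary number.
Finite designs `{m}_n` with `0 ≤ m ≤ 2^n - 1` are exactly the finite dyadic words. -/
def wordNumber : List Bool → ℕ
  | [] => 0
  | d :: w => d.toNat * 2 ^ w.length + wordNumber w

/-- The design decimal `0.d_1 d_2 ⋯ d_n = m / 2^n` of a finite design. -/
noncomputable def finiteDecimal (w : List Bool) : ℝ :=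
  (wordNumber w : ℝ) / 2 ^ w.length

/-- An infinite design `1⋯1 0⋯0 1⋯1 0⋯0 ⋯`, given by the lengths `k_0 ≥ 0`, `k_j ≥ 1 (j ≥ 1)`
of its alternating blocks of ones and zeros. -/
structure InfiniteDesign where
  run : ℕ → ℕ
  run_pos : ∀ j, 1 ≤ j → 1 ≤ run j

/-- The `j`-th segment of an infinite design: its first `2j + 1` blocks, of lengths
`k_0, …, k_{2j}`; the blocks with even index consist of ones, those with odd index of zeros. -/
def InfiniteDesign.segment (D : InfiniteDesign) (j : ℕ) : List Bool :=
  (List.range (2 * j + 1)).flatMap fun i => List.replicate (D.run i) (decide (i % 2 = 0))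

/-- `θ` is the design decimal of the infinite design `D`: the limit of the design decimals of
its segments. -/
def InfiniteDesign.IsDecimal (D : InfiniteDesign) (θ : ℝ) : Prop :=
  Tendsto (fun j => finiteDecimal (D.segment j)) atTop (𝓝 θ)

/-- `D` is a periodic design: `D = D' P P P ⋯` as infinite words, for two finite designs `D'` and
`P` with `P` not empty. (Every `D' P ⋯ P` is an initial part of the infinite word `D`.) -/
def InfiniteDesign.IsPeriodic (D : InfiniteDesign) : Prop :=
  ∃ D' P : List Bool, P ≠ [] ∧
    ∀ r : ℕ, ∃ j : ℕ, (D' ++ (List.replicate r P).flatten) <+: D.segment j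

/-- `θ` is a finite design decimal. -/
def IsFiniteDesignDecimal (θ : ℝ) : Prop :=
  ∃ w : List Bool, θ = finiteDecimal w

/-- `θ` is a periodic design decimal. -/
def IsPeriodicDesignDecimal (θ : ℝ) : Prop :=
  ∃ D : InfiniteDesign, D.IsPeriodic ∧ D.IsDecimal θ

/-- A quadratic irrational number: an irrational real root of a quadratic polynomial with integer
coefficients. -/
def IsQuadraticIrrational (x : ℝ) : Prop :=
  Irrational x ∧ ∃ a b c : ℤ, a ≠ 0 ∧ (a : ℝ) * x ^ 2 + b * x + c = 0

/-!
The assembly function conjugates the doubling map `θ ↦ 2θ mod 1` on `[0, 1)` to the Farey map on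
`[0, ∞)`, which sends `x` to `x / (1 - x)` for `x < 1` and to `x - 1` for `x ≥ 1`
(`assembly_doubling`): at dyadic points these are the two recursions `ratAssembly_low` and
`ratAssembly_high`, and a continuous extension from the dyadic points is unique. Moreover the
assembly function is strictly increasing (`assembly_strictMonoOn`). As its values at the dyadic
points already exhaust the nonnegative rationals, injectivity yields the first part.

For the second part, a number in `[0, 1)` is rational exactly if its orbit under the doubling map is
finite, and by the conjugacy this is the finiteness of the Farey orbit of `ω`. An irrational `ω`
with a finite orbit is quadratic, because a periodic point is fixed by a nontrivial integral Möbius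
transformation (`isQuadraticIrrational_of_periodic`). Conversely, the Farey map acts on integral
quadratic forms `(a, b, c)`, preserving the discriminant. As long as both roots are positive, each
step decreases `|b|`, so that eventually `ac < 0` (`exists_iterate_isReducedRoot`). This condition
then persists, and it leaves only finitely many forms of the given discriminant
(`finite_setOf_isReducedRoot`), which is Lagrange's argument in additive form.

The translation into designs goes through binary digits. The decimal of an infinite design lies in
the interior of arbitrarily fine dyadic intervals, hence is not dyadic, and the decimal of a
periodic one solves a linear equation. In the other direction, the digits of a rational number that
is not dyadic contain infinitely many zeros and ones and are eventually periodic.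
-/

/-! ### Strict monotonicity and rational values -/

theorem ratAssembly_step_lt (n m : ℕ) (h : m + 1 < 2 ^ n) :
    ratAssembly n m < ratAssembly n (m + 1) := by
  obtain ⟨m', hm'⟩ : ∃ m', m + m' + 1 = 2 ^ n := ⟨2 ^ n - m - 1, by omega⟩
  have hd := sternInt_det n m m' hm'
  have e1 : 2 ^ n - m = m' + 1 := by omega
  have e2 : 2 ^ n - (m + 1) = m' := by omega
  have p1 := sternInt_pos n (m' + 1) (by omega)
  have p2 := sternInt_pos n m' (by omega)
  unfold ratAssembly
  rw [e1, e2, div_lt_div_iff₀ (by exact_mod_cast p1) (by exact_mod_cast p2)]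
  exact_mod_cast (by omega : sternInt n m * sternInt n m' <
    sternInt n (m + 1) * sternInt n (m' + 1))

theorem ratAssembly_lt (n m n' m' : ℕ) (h' : m' < 2 ^ n')
    (h : (m : ℝ) / 2 ^ n < (m' : ℝ) / 2 ^ n') : ratAssembly n m < ratAssembly n' m' := by
  rw [div_lt_div_iff₀ (by positivity) (by positivity)] at h
  have h2 : m * 2 ^ n' < m' * 2 ^ n := by exact_mod_cast h
  have h3 : 2 ^ n * m' < 2 ^ (n' + n) := by
    rw [pow_add, mul_comm]
    exact Nat.mul_lt_mul_of_pos_right h' (by positivity)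
  rw [← ratAssembly_refine n m n', ← ratAssembly_refine n' m' n, add_comm n n']
  exact (ratAssembly_step_lt _ _ (by linarith)).trans_le (ratAssembly_mono _ _ _ (by linarith) h3)

theorem assembly_strictMonoOn : StrictMonoOn assembly (Ico 0 1) := by
  intro x hx y hy hxy
  obtain ⟨n, m, hm, h1, h2⟩ := dyadicSet_between x y hx.1 hxy hy.2.le
  obtain ⟨n', m', hm', h3, h4⟩ := dyadicSet_between _ y (by positivity) h2 hy.2.le
  have a1 := assembly_monotoneOn hx ⟨hx.1.trans h1.le, h2.trans hy.2⟩ h1.le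
  have a2 := assembly_monotoneOn ⟨hx.1.trans (h1.trans h3).le, h4.trans hy.2⟩ hy h4.le
  rw [assembly_dyadic n m hm] at a1
  rw [assembly_dyadic n' m' hm'] at a2
  exact a1.trans_lt ((ratAssembly_lt n m n' m' hm' h3).trans_le a2)

theorem assembly_half : assembly (1 / 2) = 1 := by
  simpa [ratAssembly, sternInt] using assembly_dyadic 1 1 (by simp)

theorem exists_dyadic_assembly_eq (q : ℚ) (hq : 0 ≤ q) :
    ∃ n m : ℕ, m < 2 ^ n ∧ assembly ((m : ℝ) / 2 ^ n) = q := by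
  obtain ⟨n, m, hm, he⟩ := ratAssembly_surj _ q.num.toNat q.den le_rfl q.den_pos
  refine ⟨n, m, hm, ?_⟩
  rw [assembly_dyadic n m hm, he]
  have h1 : ((q.num.toNat : ℤ) : ℝ) = q.num := by
    rw [Int.toNat_of_nonneg (Rat.num_nonneg.2 hq)]
  rw [Rat.cast_def, ← h1, Int.cast_natCast]

theorem assembly_rational_iff {θ : ℝ} (hθ : θ ∈ Ico (0 : ℝ) 1) :
    (∃ q : ℚ, assembly θ = (q : ℝ)) ↔ θ ∈ dyadicSet := by
  constructor
  · rintro ⟨q, hq⟩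
    obtain ⟨n, m, hm, he⟩ := exists_dyadic_assembly_eq q
      (by exact_mod_cast hq ▸ assembly_nonneg θ)
    refine ⟨n, m, hm, assembly_strictMonoOn.injOn hθ ⟨by positivity, ?_⟩ (hq.trans he.symm)⟩
    rw [div_lt_one (by positivity)]; exact_mod_cast hm
  · rintro ⟨n, m, hm, rfl⟩
    rw [assembly_dyadic n m hm]
    exact ⟨(sternInt n m : ℚ) / sternInt n (2 ^ n - m), by simp [ratAssembly]⟩

/-! ### The doubling map and the Farey map -/

/-- The doubling map `θ ↦ 2θ mod 1` on `[0, 1)`, which drops the first binary digit. -/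
noncomputable def doubling (θ : ℝ) : ℝ := if θ < 1 / 2 then 2 * θ else 2 * θ - 1

/-- The Farey map on `[0, ∞)`: the inverse of `y ↦ y / (1 + y)` on `[0, 1)` and of `y ↦ y + 1`
on `[1, ∞)`. -/
noncomputable def fareyMap (x : ℝ) : ℝ := if x < 1 then x / (1 - x) else x - 1

theorem doubling_mem {θ : ℝ} (hθ : θ ∈ Ico (0 : ℝ) 1) : doubling θ ∈ Ico (0 : ℝ) 1 := by
  obtain ⟨h0, h1⟩ := hθ
  unfold doubling
  split_ifs with h <;> constructor <;> linarith

theorem doubling_iterate_mem {θ : ℝ} (hθ : θ ∈ Ico (0 : ℝ) 1) (n : ℕ) :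
    doubling^[n] θ ∈ Ico (0 : ℝ) 1 := by
  induction n with
  | zero => exact hθ
  | succ n ih => rw [Function.iterate_succ_apply']; exact doubling_mem ih

theorem assembly_lt_one {θ : ℝ} (h0 : 0 ≤ θ) (h : θ < 1 / 2) : assembly θ < 1 := by
  rw [← assembly_half]
  exact assembly_strictMonoOn ⟨h0, by linarith⟩ (by norm_num) h

theorem one_le_assembly {θ : ℝ} (h : 1 / 2 ≤ θ) (h1 : θ < 1) : 1 ≤ assembly θ := by
  rw [← assembly_half]
  exact assembly_monotoneOn (by norm_num) ⟨by linarith, h1⟩ h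

/-- Both sides of the equation extend the rational assembly function continuously. -/
theorem assembly_left_half {θ : ℝ} (hθ : θ ∈ Ico (0 : ℝ) 1) :
    assembly (θ / 2) / (1 - assembly (θ / 2)) = assembly θ := by
  refine assembly_unique (fun θ => assembly (θ / 2) / (1 - assembly (θ / 2))) ?_ ?_ hθ
  · have hc : ContinuousOn (fun θ : ℝ => assembly (θ / 2)) (Ico 0 1) :=
      assembly_continuousOn.comp (by fun_prop) fun x hx => ⟨by linarith [hx.1], by linarith [hx.2]⟩
    refine hc.div (continuousOn_const.sub hc) fun x hx => ?_
    have := assembly_lt_one (θ := x / 2) (by linarith [hx.1]) (by linarith [hx.2])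
    linarith
  · intro n m hm
    have e : (m : ℝ) / 2 ^ n / 2 = m / 2 ^ (n + 1) := by rw [pow_succ, div_div]
    have := ratAssembly_nonneg n m
    rw [e, assembly_dyadic (n + 1) m (by rw [pow_succ]; omega), ratAssembly_low n m hm]
    field_simp
    ring

theorem assembly_right_half {θ : ℝ} (hθ : θ ∈ Ico (0 : ℝ) 1) :
    assembly ((1 + θ) / 2) - 1 = assembly θ := by
  refine assembly_unique (fun θ => assembly ((1 + θ) / 2) - 1) ?_ ?_ hθ
  · refine ContinuousOn.sub (assembly_continuousOn.comp (by fun_prop) fun x hx => ?_)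
      continuousOn_const
    exact ⟨by linarith [hx.1], by linarith [hx.2]⟩
  · intro n m hm
    have e : (1 + (m : ℝ) / 2 ^ n) / 2 = ((2 ^ n + m : ℕ) : ℝ) / 2 ^ (n + 1) := by
      push_cast
      rw [pow_succ]
      field_simp
    rw [e, assembly_dyadic (n + 1) _ (by rw [pow_succ]; omega), ratAssembly_high n m hm]
    ring

/-- The assembly function conjugates the doubling map to the Farey map. -/
theorem assembly_doubling {θ : ℝ} (hθ : θ ∈ Ico (0 : ℝ) 1) :
    assembly (doubling θ) = fareyMap (assembly θ) := by
  unfold doubling fareyMap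
  split_ifs with h h' h'
  · rw [← assembly_left_half ⟨by linarith [hθ.1], by linarith⟩, mul_div_cancel_left₀ _ two_ne_zero]
  · exact absurd (assembly_lt_one hθ.1 h) h'
  · exact absurd h' (not_lt.2 (one_le_assembly (not_lt.1 h) hθ.2))
  · rw [← assembly_right_half ⟨by linarith, by linarith [hθ.2]⟩]
    congr 2
    ring

theorem assembly_doubling_iterate {θ : ℝ} (hθ : θ ∈ Ico (0 : ℝ) 1) (n : ℕ) :
    assembly (doubling^[n] θ) = fareyMap^[n] (assembly θ) := by
  induction n with
  | zero => rfl
  | succ n ih =>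
    rw [Function.iterate_succ_apply', Function.iterate_succ_apply', ← ih,
      assembly_doubling (doubling_iterate_mem hθ n)]

/-! ### Irrational orbits of the Farey map -/

theorem Irrational.int_mul_add_int_ne_zero {x : ℝ} (hx : Irrational x) {a : ℤ} (ha : a ≠ 0)
    (c : ℤ) : (a : ℝ) * x + c ≠ 0 := by
  exact_mod_cast ((hx.intCast_mul ha).add_intCast c).ne_int 0

theorem fareyMap_irrational_pos {x : ℝ} (hx : Irrational x) (h0 : 0 < x) :
    Irrational (fareyMap x) ∧ 0 < fareyMap x := by
  unfold fareyMap
  split_ifs with h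
  · have h1 : 0 < 1 - x := by linarith
    refine ⟨?_, div_pos h0 h1⟩
    have e : x / (1 - x) = (1 - x)⁻¹ - (1 : ℕ) := by push_cast; field_simp; ring
    rw [e]
    refine Irrational.sub_natCast (Irrational.inv ?_) 1
    exact_mod_cast hx.natCast_sub 1
  · have h1 : x ≠ 1 := by exact_mod_cast hx.ne_nat 1
    refine ⟨by exact_mod_cast hx.sub_natCast 1, ?_⟩
    have := lt_of_le_of_ne (not_lt.1 h) h1.symm
    linarith

theorem fareyMap_iterate_irrational_pos {x : ℝ} (hx : Irrational x) (h0 : 0 < x) (n : ℕ) :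
    Irrational (fareyMap^[n] x) ∧ 0 < fareyMap^[n] x := by
  induction n with
  | zero => exact ⟨hx, h0⟩
  | succ n ih =>
    rw [Function.iterate_succ_apply']
    exact fareyMap_irrational_pos ih.1 ih.2

/-- One of the two inverse branches of the Farey map recovers `x` from its image. -/
theorem eq_of_fareyMap {x : ℝ} (hx : Irrational x) (h0 : 0 < x) :
    (x < 1 ∧ x * (1 + fareyMap x) = fareyMap x) ∨ (1 < x ∧ x = fareyMap x + 1) := by
  unfold fareyMap
  split_ifs with h
  · have h1 : 1 - x ≠ 0 := by linarith
    refine Or.inl ⟨h, ?_⟩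
    field_simp
    ring
  · have h1 : x ≠ 1 := by exact_mod_cast hx.ne_nat 1
    exact Or.inr ⟨lt_of_le_of_ne (not_lt.1 h) h1.symm, by ring⟩

/-! ### Periodic points are quadratic -/

/-- A point is the image of its `n`-th iterate under an element of `SL₂(ℕ)`, a product of `n`
elementary matrices; its entry sum grows with every factor. -/
theorem exists_moebius_fareyMap_iterate {x : ℝ} (hx : Irrational x) (h0 : 0 < x) (n : ℕ) :
    ∃ p q r s : ℤ, 0 ≤ p ∧ 0 ≤ q ∧ 0 ≤ r ∧ 0 ≤ s ∧ p * s - q * r = 1 ∧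
      (n : ℤ) + 2 ≤ p + q + r + s ∧
      x * (r * fareyMap^[n] x + s) = p * fareyMap^[n] x + q := by
  induction n with
  | zero => exact ⟨1, 0, 0, 1, by simp⟩
  | succ n ih =>
    obtain ⟨p, q, r, s, hp, hq, hr, hs, hdet, hsum, he⟩ := ih
    obtain ⟨hi, hpos⟩ := fareyMap_iterate_irrational_pos hx h0 n
    rw [Function.iterate_succ_apply']
    have hz := (fareyMap_irrational_pos hi hpos).2
    generalize fareyMap^[n] x = y at *
    rcases eq_of_fareyMap hi hpos with ⟨-, h⟩ | ⟨-, h⟩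
    · have h1 : 1 ≤ q + s := by
        by_contra! hc
        obtain rfl : q = 0 := by omega
        obtain rfl : s = 0 := by omega
        simp at hdet
      refine ⟨p + q, q, r + s, s, by omega, hq, by omega, hs, by linarith, by push_cast; omega, ?_⟩
      push_cast
      linear_combination (1 + fareyMap y) * he + (p - x * r) * h
    · have h1 : 1 ≤ p + r := by
        by_contra! hc
        obtain rfl : p = 0 := by omega
        obtain rfl : r = 0 := by omega
        simp at hdet
      refine ⟨p, q + p, r, s + r, hp, by omega, hr, by omega, by linarith, by push_cast; omega, ?_⟩
      push_cast
      linear_combination he + (p - x * r) * h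

theorem isQuadraticIrrational_of_periodic {x : ℝ} (hx : Irrational x) (h0 : 0 < x) {n : ℕ}
    (hn : 0 < n) (hper : fareyMap^[n] x = x) : IsQuadraticIrrational x := by
  obtain ⟨p, q, r, s, hp, hq, hr, hs, hdet, hsum, he⟩ := exists_moebius_fareyMap_iterate hx h0 n
  rw [hper] at he
  refine ⟨hx, r, s - p, -q, ?_, by push_cast; linear_combination he⟩
  -- If `r = 0`, the matrix is a translation fixing `x`, hence the identity, of entry sum `2`.
  rintro rfl
  have hps : p * s = 1 := by linarith
  obtain rfl : p = 1 := Int.eq_one_of_mul_eq_one_right hp hps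
  obtain rfl : s = 1 := by linarith
  have : (q : ℝ) = 0 := by push_cast at he; linarith
  have : q = 0 := by exact_mod_cast this
  omega

theorem isQuadraticIrrational_of_fareyMap {x : ℝ} (hx : Irrational x) (h0 : 0 < x)
    (h : IsQuadraticIrrational (fareyMap x)) : IsQuadraticIrrational x := by
  obtain ⟨hy, a, b, c, ha, he⟩ := h
  have hpos := (fareyMap_irrational_pos hx h0).2
  rcases eq_of_fareyMap hx h0 with ⟨hlt, hf⟩ | ⟨-, hf⟩
  · refine ⟨hx, a - b + c, b - 2 * c, c, ?_, ?_⟩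
    · -- Otherwise the polynomial has the rational root `-1`, and so a second rational root.
      intro hc
      have hb : (b : ℝ) = a + c := by
        have : b = a + c := by linarith
        exact_mod_cast this
      refine hy.int_mul_add_int_ne_zero ha c ?_
      have h1 : fareyMap x + 1 ≠ 0 := by linarith
      apply mul_left_cancel₀ h1
      rw [hb] at he
      linear_combination he
    · have h1 : fareyMap x = x / (1 - x) := by
        rw [eq_div_iff (by linarith)]; linear_combination -hf
      have h2 : 1 - x ≠ 0 := by linarith
      rw [h1] at he
      field_simp at he
      push_cast
      linear_combination he
  · refine ⟨hx, a, b - 2 * a, a - b + c, ha, ?_⟩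
    have h1 : fareyMap x = x - 1 := by linarith
    rw [h1] at he
    push_cast
    linear_combination he

theorem isQuadraticIrrational_of_fareyMap_iterate {x : ℝ} (hx : Irrational x) (h0 : 0 < x) (n : ℕ)
    (h : IsQuadraticIrrational (fareyMap^[n] x)) : IsQuadraticIrrational x := by
  induction n with
  | zero => exact h
  | succ n ih =>
    rw [Function.iterate_succ_apply'] at h
    obtain ⟨hi, hpos⟩ := fareyMap_iterate_irrational_pos hx h0 n
    exact ih (isQuadraticIrrational_of_fareyMap hi hpos h)

/-! ### Quadratic irrationals have finite orbits -/

/-- `x` is a root of a form `aX² + bX + c` with `a > 0 > c` of discriminant `D`: the quadratic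
`x` has a negative conjugate. -/
def IsReducedRoot (D : ℤ) (x : ℝ) : Prop :=
  ∃ a b c : ℤ, 0 < a ∧ c < 0 ∧ b ^ 2 - 4 * a * c = D ∧ (a : ℝ) * x ^ 2 + b * x + c = 0

/-- The integer polynomial that `fareyMap x` satisfies, one case for each branch. -/
theorem fareyMap_root {x : ℝ} (hx : Irrational x) (h0 : 0 < x) {a b c : ℤ}
    (he : (a : ℝ) * x ^ 2 + b * x + c = 0) :
    (1 < x ∧ (a : ℝ) * fareyMap x ^ 2 + (b + 2 * a : ℤ) * fareyMap x + (a + b + c : ℤ) = 0) ∨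
    (x < 1 ∧ ((a + b + c : ℤ) : ℝ) * fareyMap x ^ 2 + (b + 2 * c : ℤ) * fareyMap x + c = 0) := by
  rcases eq_of_fareyMap hx h0 with ⟨hlt, hf⟩ | ⟨hlt, hf⟩
  · right
    refine ⟨hlt, ?_⟩
    push_cast
    linear_combination (1 + fareyMap x) ^ 2 * he
      - (a * (x * (1 + fareyMap x) + fareyMap x) + b * (1 + fareyMap x)) * hf
  · left
    refine ⟨hlt, ?_⟩
    push_cast
    linear_combination he - (a * (x + fareyMap x + 1) + b) * hf

theorem IsReducedRoot.fareyMap {D : ℤ} {x : ℝ} (hx : Irrational x) (h0 : 0 < x)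
    (h : IsReducedRoot D x) : IsReducedRoot D (fareyMap x) := by
  obtain ⟨a, b, c, ha, hc, hD, he⟩ := h
  have ha' : (0 : ℝ) < a := by exact_mod_cast ha
  have hc' : (c : ℝ) < 0 := by exact_mod_cast hc
  -- The sign of the value at `1` tells on which side of `1` the positive root lies.
  have key : x * ((a + b + c : ℤ) : ℝ) = (x - 1) * (c - a * x) := by
    push_cast
    linear_combination he
  have hneg : (c : ℝ) - a * x < 0 := by nlinarith
  rcases fareyMap_root hx h0 he with ⟨h1, h2⟩ | ⟨h1, h2⟩
  · refine ⟨a, b + 2 * a, a + b + c, ha, ?_, by linear_combination hD, h2⟩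
    have : x * ((a + b + c : ℤ) : ℝ) < 0 := by
      rw [key]; exact mul_neg_of_pos_of_neg (by linarith) hneg
    exact_mod_cast (pos_iff_neg_of_mul_neg this).1 h0
  · refine ⟨a + b + c, b + 2 * c, c, ?_, hc, by linear_combination hD, h2⟩
    have : 0 < x * ((a + b + c : ℤ) : ℝ) := by
      rw [key]; exact mul_pos_of_neg_of_neg (by linarith) hneg
    exact_mod_cast (pos_iff_pos_of_mul_pos this).1 h0

/-- As long as both roots are positive, the linear coefficient is negative and each step of the
Farey map decreases its absolute value; hence the roots are separated eventually. -/
theorem exists_iterate_isReducedRoot (k : ℕ) {x : ℝ} (hx : Irrational x) (h0 : 0 < x)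
    {a b c : ℤ} (ha : 0 < a) (hk : -b ≤ k) (he : (a : ℝ) * x ^ 2 + b * x + c = 0) :
    ∃ n D, IsReducedRoot D (fareyMap^[n] x) := by
  induction k generalizing x a b c with
  | zero =>
    rcases lt_or_ge c 0 with hc | hc
    · exact ⟨0, _, a, b, c, ha, hc, rfl, he⟩
    · exfalso
      have ha' : (0 : ℝ) < a := by exact_mod_cast ha
      have hb' : (0 : ℝ) ≤ b := by exact_mod_cast (by simpa using hk : 0 ≤ b)
      have hc' : (0 : ℝ) ≤ c := by exact_mod_cast hc
      have : 0 < (a : ℝ) * x ^ 2 + b * x + c := by positivity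
      exact this.ne' he
  | succ k ih =>
    obtain ⟨hi, hpos⟩ := fareyMap_irrational_pos hx h0
    rcases lt_trichotomy c 0 with hc | rfl | hc
    · exact ⟨0, _, a, b, c, ha, hc, rfl, he⟩
    · exfalso
      refine hx.int_mul_add_int_ne_zero ha.ne' b (mul_left_cancel₀ h0.ne' ?_)
      push_cast at he
      linear_combination he
    · suffices ∃ n D, IsReducedRoot D (fareyMap^[n] (fareyMap x)) by
        obtain ⟨n, D, h⟩ := this
        exact ⟨n + 1, D, h⟩
      push_cast at hk
      rcases fareyMap_root hx h0 he with ⟨-, h2⟩ | ⟨-, h2⟩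
      · exact ih hi hpos ha (by omega) h2
      · rcases lt_trichotomy (a + b + c) 0 with hs | hs | hs
        · refine ⟨0, _, -(a + b + c), -(b + 2 * c), -c, by omega, by omega, rfl, ?_⟩
          push_cast at h2 ⊢
          rw [Function.iterate_zero_apply]
          linear_combination -h2
        · exfalso
          rw [hs] at h2
          refine hi.int_mul_add_int_ne_zero (a := b + 2 * c) ?_ c (by simpa using h2)
          intro hb
          rw [hb] at h2
          simp at h2
          omega
        · exact ih hi hpos hs (by omega) h2

theorem IsReducedRoot.iterate {D : ℤ} {x : ℝ} (hx : Irrational x) (h0 : 0 < x)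
    (h : IsReducedRoot D x) (n : ℕ) : IsReducedRoot D (_root_.fareyMap^[n] x) := by
  induction n with
  | zero => exact h
  | succ n ih =>
    rw [Function.iterate_succ_apply']
    obtain ⟨hi, hpos⟩ := fareyMap_iterate_irrational_pos hx h0 n
    exact ih.fareyMap hi hpos

/-- All three coefficients of a form with `a > 0 > c` are bounded by the discriminant. -/
theorem finite_setOf_isReducedRoot (D : ℤ) : {x : ℝ | 0 < x ∧ IsReducedRoot D x}.Finite := by
  have hbox : (Icc (-D) D ×ˢ (Icc (-D) D ×ˢ Icc (-D) D) : Set (ℤ × ℤ × ℤ)).Finite :=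
    (finite_Icc _ _).prod ((finite_Icc _ _).prod (finite_Icc _ _))
  refine (hbox.biUnion (t := fun f => {x : ℝ | 0 < x ∧ 0 < f.1 ∧ f.2.2 < 0 ∧
    (f.1 : ℝ) * x ^ 2 + f.2.1 * x + f.2.2 = 0}) ?_).subset ?_
  · -- Such a polynomial has at most one positive root.
    rintro ⟨a, b, c⟩ -
    refine Set.Subsingleton.finite ?_
    rintro x ⟨hx, ha, hc, ex⟩ y ⟨hy, -, -, ey⟩
    simp only at ha hc ex ey
    have ha' : (0 : ℝ) < a := by exact_mod_cast ha
    have hc' : (c : ℝ) < 0 := by exact_mod_cast hc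
    by_contra hne
    have h1 : (a : ℝ) * x * y - c = 0 := by
      apply mul_left_cancel₀ (sub_ne_zero.2 hne)
      linear_combination y * ex - x * ey
    have : 0 < (a : ℝ) * x * y := by positivity
    linarith
  · rintro x ⟨hx, a, b, c, ha, hc, hD, he⟩
    have hac : 0 < a * -c := mul_pos ha (by omega)
    have h1 : a ≤ a * -c := by nlinarith
    have h2 : -c ≤ a * -c := by nlinarith
    have hb : |b| ≤ b ^ 2 := by
      rw [← sq_abs]
      nlinarith [Int.le_self_sq |b|]
    obtain ⟨hb1, hb2⟩ := abs_le.1 hb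
    have hb0 := sq_nonneg b
    refine mem_biUnion (x := (a, b, c)) ?_ ⟨hx, ha, hc, he⟩
    simp only [mem_prod, mem_Icc]
    refine ⟨⟨?_, ?_⟩, ⟨?_, ?_⟩, ?_, ?_⟩ <;> nlinarith

/-- A form of Lagrange's theorem on periodic continued fractions. -/
theorem IsQuadraticIrrational.exists_iterate_eq {x : ℝ} (h0 : 0 < x)
    (h : IsQuadraticIrrational x) : ∃ m n, m < n ∧ fareyMap^[m] x = fareyMap^[n] x := by
  obtain ⟨hx, a, b, c, ha, he⟩ := h
  obtain ⟨N, D, hN⟩ : ∃ n D, IsReducedRoot D (fareyMap^[n] x) := by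
    rcases ha.lt_or_gt with ha | ha
    · refine exists_iterate_isReducedRoot (a := -a) (b := -b) (c := -c) b.toNat hx h0 (by omega)
        (by omega) ?_
      push_cast
      linear_combination -he
    · exact exists_iterate_isReducedRoot (-b).toNat hx h0 ha (by omega) he
  obtain ⟨hi, hpos⟩ := fareyMap_iterate_irrational_pos hx h0 N
  obtain ⟨m, n, hmn, heq⟩ := (finite_setOf_isReducedRoot D).exists_lt_map_eq_of_forall_mem
    (f := fun n => fareyMap^[n] (fareyMap^[N] x)) fun n => by
      exact ⟨(fareyMap_iterate_irrational_pos hi hpos n).2, hN.iterate hi hpos n⟩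
  simp only [← Function.iterate_add_apply] at heq
  exact ⟨m + N, n + N, by omega, heq⟩

/-! ### Rational points of the doubling map -/

theorem exists_doubling_iterate_eq (θ : ℝ) (n : ℕ) :
    ∃ k : ℤ, doubling^[n] θ = 2 ^ n * θ - k := by
  induction n with
  | zero => exact ⟨0, by simp⟩
  | succ n ih =>
    obtain ⟨k, hk⟩ := ih
    rw [Function.iterate_succ_apply', doubling]
    split_ifs
    · exact ⟨2 * k, by rw [hk]; push_cast; ring⟩
    · exact ⟨2 * k + 1, by rw [hk]; push_cast; ring⟩

theorem exists_rat_of_doubling_iterate_eq {θ : ℝ} {m n : ℕ} (hmn : m < n)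
    (h : doubling^[m] θ = doubling^[n] θ) : ∃ q : ℚ, θ = q := by
  obtain ⟨k, hk⟩ := exists_doubling_iterate_eq θ m
  obtain ⟨l, hl⟩ := exists_doubling_iterate_eq θ n
  rw [hk, hl] at h
  have hlt : (2 : ℝ) ^ m < 2 ^ n := pow_lt_pow_right₀ one_lt_two hmn
  refine ⟨(l - k) / (2 ^ n - 2 ^ m), ?_⟩
  push_cast
  rw [eq_div_iff (by linarith)]
  linear_combination -h

theorem exists_doubling_iterate_eq_of_rat {θ : ℝ} (hθ : θ ∈ Ico (0 : ℝ) 1) {q : ℚ} (hq : θ = q) :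
    ∃ m n, m < n ∧ doubling^[m] θ = doubling^[n] θ := by
  have hd : (0 : ℝ) < q.den := by exact_mod_cast q.den_pos
  -- The orbit stays among the fractions in `[0, 1)` with the denominator of `θ`.
  have hfin : ((fun k : ℤ => (k : ℝ) / q.den) '' Icc 0 q.den).Finite := (finite_Icc _ _).image _
  refine hfin.exists_lt_map_eq_of_forall_mem fun n => ?_
  obtain ⟨k, hk⟩ := exists_doubling_iterate_eq θ n
  obtain ⟨h0, h1⟩ := doubling_iterate_mem hθ n
  have e : ((2 ^ n * q.num - k * q.den : ℤ) : ℝ) / q.den = doubling^[n] θ := by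
    rw [hk, hq, Rat.cast_def]
    push_cast
    field_simp
  refine ⟨2 ^ n * q.num - k * q.den, ⟨?_, ?_⟩, e⟩
  · rw [← e, le_div_iff₀ hd, zero_mul] at h0
    exact_mod_cast h0
  · rw [← e, div_lt_one hd] at h1
    exact_mod_cast h1.le

theorem irrational_assembly_iff {θ : ℝ} (hθ : θ ∈ Ico (0 : ℝ) 1) :
    Irrational (assembly θ) ↔ θ ∉ dyadicSet := by
  rw [← assembly_rational_iff hθ, Irrational, mem_range]
  simp only [eq_comm]

theorem isQuadraticIrrational_assembly_iff {θ : ℝ} (hθ : θ ∈ Ico (0 : ℝ) 1) :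
    IsQuadraticIrrational (assembly θ) ↔ (∃ q : ℚ, θ = (q : ℝ)) ∧ θ ∉ dyadicSet := by
  have hpos (hx : Irrational (assembly θ)) : 0 < assembly θ :=
    lt_of_le_of_ne (assembly_nonneg θ) fun h => hx ⟨0, by simpa using h⟩
  constructor
  · intro h
    refine ⟨?_, (irrational_assembly_iff hθ).1 h.1⟩
    obtain ⟨m, n, hmn, he⟩ := h.exists_iterate_eq (hpos h.1)
    rw [← assembly_doubling_iterate hθ, ← assembly_doubling_iterate hθ] at he
    exact exists_rat_of_doubling_iterate_eq hmn (assembly_strictMonoOn.injOn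
      (doubling_iterate_mem hθ m) (doubling_iterate_mem hθ n) he)
  · rintro ⟨⟨q, hq⟩, hd⟩
    have hx := (irrational_assembly_iff hθ).2 hd
    obtain ⟨m, n, hmn, he⟩ := exists_doubling_iterate_eq_of_rat hθ hq
    obtain ⟨k, rfl⟩ := Nat.exists_eq_add_of_lt hmn
    obtain ⟨hi, hp⟩ := fareyMap_iterate_irrational_pos hx (hpos hx) m
    refine isQuadraticIrrational_of_fareyMap_iterate hx (hpos hx) m
      (isQuadraticIrrational_of_periodic hi hp (n := k + 1) (by omega) ?_)
    rw [← Function.iterate_add_apply, ← assembly_doubling_iterate hθ,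
      ← assembly_doubling_iterate hθ, he]
    congr 2
    omega

/-! ### Binary words -/

theorem wordNumber_append (u v : List Bool) :
    wordNumber (u ++ v) = wordNumber u * 2 ^ v.length + wordNumber v := by
  induction u with
  | nil => simp [wordNumber]
  | cons d u ih =>
    simp only [List.cons_append, wordNumber, ih, List.length_append, pow_add]
    ring

theorem wordNumber_lt (w : List Bool) : wordNumber w < 2 ^ w.length := by
  induction w with
  | nil => simp [wordNumber]
  | cons d w ih =>
    simp only [wordNumber, List.length_cons, pow_succ]
    cases d <;> simp <;> omega

theorem exists_wordNumber_eq (n m : ℕ) (h : m < 2 ^ n) :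
    ∃ w : List Bool, w.length = n ∧ wordNumber w = m := by
  induction n generalizing m with
  | zero => exact ⟨[], rfl, by simp at h; simp [wordNumber, h]⟩
  | succ n ih =>
    rw [pow_succ] at h
    rcases lt_or_ge m (2 ^ n) with hm | hm
    · obtain ⟨w, hl, hw⟩ := ih m hm
      exact ⟨false :: w, by simp [hl], by simp [wordNumber, hw]⟩
    · obtain ⟨w, hl, hw⟩ := ih (m - 2 ^ n) (by omega)
      exact ⟨true :: w, by simp [hl], by simp [wordNumber, hw, hl]; omega⟩

theorem isFiniteDesignDecimal_iff (θ : ℝ) : IsFiniteDesignDecimal θ ↔ θ ∈ dyadicSet := by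
  constructor
  · rintro ⟨w, rfl⟩
    exact ⟨w.length, wordNumber w, wordNumber_lt w, rfl⟩
  · rintro ⟨n, m, hm, rfl⟩
    obtain ⟨w, rfl, rfl⟩ := exists_wordNumber_eq n m hm
    exact ⟨w, rfl⟩

theorem finiteDecimal_append (u v : List Bool) :
    finiteDecimal (u ++ v) = finiteDecimal u + finiteDecimal v / 2 ^ u.length := by
  simp only [finiteDecimal, wordNumber_append, List.length_append, pow_add]
  push_cast
  field_simp

theorem finiteDecimal_nonneg (w : List Bool) : 0 ≤ finiteDecimal w := by
  unfold finiteDecimal; positivity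

/-- The decimals of the words with prefix `w` lie in an interval of length `2 ^ (-|w|)` starting at
`finiteDecimal w`; this is its right end point. -/
noncomputable def finiteDecimalUpper (w : List Bool) : ℝ :=
  finiteDecimal w + 1 / 2 ^ w.length

theorem finiteDecimal_le_of_prefix {u w : List Bool} (h : u <+: w) :
    finiteDecimal u ≤ finiteDecimal w := by
  obtain ⟨v, rfl⟩ := h
  rw [finiteDecimal_append]
  have := finiteDecimal_nonneg v
  have : 0 ≤ finiteDecimal v / 2 ^ u.length := by positivity
  linarith

theorem finiteDecimalUpper_append (u v : List Bool) :
    finiteDecimalUpper (u ++ v) = finiteDecimal u + finiteDecimalUpper v / 2 ^ u.length := by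
  simp only [finiteDecimalUpper, finiteDecimal_append, List.length_append, pow_add]
  field_simp
  ring

theorem finiteDecimalUpper_le_one (w : List Bool) : finiteDecimalUpper w ≤ 1 := by
  have h : (wordNumber w : ℝ) + 1 ≤ 2 ^ w.length := by exact_mod_cast wordNumber_lt w
  rw [finiteDecimalUpper, finiteDecimal, ← add_div]
  exact div_le_one_of_le₀ h (by positivity)

theorem finiteDecimalUpper_le_of_prefix {u w : List Bool} (h : u <+: w) :
    finiteDecimalUpper w ≤ finiteDecimalUpper u := by
  obtain ⟨v, rfl⟩ := h
  rw [finiteDecimalUpper_append, finiteDecimalUpper.eq_1 u]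
  have := div_le_div_of_nonneg_right (finiteDecimalUpper_le_one v)
    (by positivity : (0 : ℝ) ≤ 2 ^ u.length)
  linarith

theorem finiteDecimal_lt_of_append_true (u : List Bool) :
    finiteDecimal u < finiteDecimal (u ++ [true]) := by
  rw [finiteDecimal_append]
  have : 0 < finiteDecimal [true] / 2 ^ u.length := by
    simp [finiteDecimal, wordNumber]
  linarith

theorem finiteDecimalUpper_append_false_lt (u : List Bool) :
    finiteDecimalUpper (u ++ [false]) < finiteDecimalUpper u := by
  rw [finiteDecimalUpper_append, finiteDecimalUpper.eq_1 u]
  have h : finiteDecimalUpper [false] < 1 := by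
    norm_num [finiteDecimalUpper, finiteDecimal, wordNumber]
  have := div_lt_div_of_pos_right h (by positivity : (0 : ℝ) < 2 ^ u.length)
  linarith

/-! ### The decimal of an infinite design -/

namespace InfiniteDesign

variable (D : InfiniteDesign)

theorem segment_succ (j : ℕ) : D.segment (j + 1) =
    D.segment j ++ List.replicate (D.run (2 * j + 1)) false
      ++ List.replicate (D.run (2 * j + 2)) true := by
  have h1 : (2 * j + 1) % 2 = 1 := by omega
  have h2 : (2 * j + 2) % 2 = 0 := by omega
  simp [segment, show 2 * (j + 1) + 1 = 2 * j + 1 + 1 + 1 by ring, List.range_succ, h1, h2,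
    List.flatMap_append]

theorem segment_prefix {i j : ℕ} (h : i ≤ j) : D.segment i <+: D.segment j := by
  induction j, h using Nat.le_induction with
  | base => exact List.prefix_rfl
  | succ k _ ih =>
    rw [segment_succ, List.append_assoc]
    exact ih.trans (List.prefix_append _ _)

theorem le_length_segment (j : ℕ) : j ≤ (D.segment j).length := by
  induction j with
  | zero => simp
  | succ j ih =>
    have := D.run_pos (2 * j + 1) (by omega)
    simp only [segment_succ, List.length_append, List.length_replicate]
    omega

theorem finiteDecimal_segment_lt_succ (j : ℕ) :
    finiteDecimal (D.segment j) < finiteDecimal (D.segment (j + 1)) := by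
  obtain ⟨k, hk⟩ := Nat.exists_eq_add_of_le' (D.run_pos (2 * j + 2) (by omega))
  rw [segment_succ, hk, List.replicate_succ', ← List.append_assoc]
  refine (finiteDecimal_le_of_prefix ?_).trans_lt (finiteDecimal_lt_of_append_true _)
  rw [List.append_assoc]
  exact List.prefix_append _ _

theorem finiteDecimalUpper_segment_succ_lt (j : ℕ) :
    finiteDecimalUpper (D.segment (j + 1)) < finiteDecimalUpper (D.segment j) := by
  obtain ⟨k, hk⟩ := Nat.exists_eq_add_of_le' (D.run_pos (2 * j + 1) (by omega))
  rw [segment_succ, hk, List.replicate_succ]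
  refine (finiteDecimalUpper_le_of_prefix ?_).trans_lt (finiteDecimalUpper_append_false_lt _)
  simp

variable {D} {θ : ℝ}

theorem IsDecimal.mem_Icc (h : D.IsDecimal θ) (i : ℕ) :
    θ ∈ Icc (finiteDecimal (D.segment i)) (finiteDecimalUpper (D.segment i)) := by
  refine ⟨ge_of_tendsto h ?_, le_of_tendsto h ?_⟩ <;>
    filter_upwards [eventually_ge_atTop i] with j hj
  · exact finiteDecimal_le_of_prefix (D.segment_prefix hj)
  · refine le_trans ?_ (finiteDecimalUpper_le_of_prefix (D.segment_prefix hj))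
    rw [finiteDecimalUpper]
    have : (0 : ℝ) ≤ 1 / 2 ^ (D.segment j).length := by positivity
    linarith

theorem IsDecimal.mem_Ioo (h : D.IsDecimal θ) (i : ℕ) :
    θ ∈ Ioo (finiteDecimal (D.segment i)) (finiteDecimalUpper (D.segment i)) :=
  ⟨(D.finiteDecimal_segment_lt_succ i).trans_le (h.mem_Icc (i + 1)).1,
    (h.mem_Icc (i + 1)).2.trans_lt (D.finiteDecimalUpper_segment_succ_lt i)⟩

/-- Infinitely many letters of an infinite design are `0` and infinitely many are `1`, so that its
decimal is interior to arbitrarily fine dyadic intervals. -/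
theorem IsDecimal.notMem_dyadicSet (h : D.IsDecimal θ) : θ ∉ dyadicSet := by
  rintro ⟨n, m, -, rfl⟩
  obtain ⟨h1, h2⟩ := h.mem_Ioo n
  obtain ⟨k, hk⟩ := Nat.exists_eq_add_of_le (D.le_length_segment n)
  rw [finiteDecimalUpper, finiteDecimal, ← add_div] at h2
  rw [finiteDecimal] at h1
  rw [hk] at h1 h2
  have e : (m : ℝ) / 2 ^ n = ((m * 2 ^ k : ℕ) : ℝ) / 2 ^ (n + k) := by
    push_cast
    rw [pow_add]
    field_simp
  rw [e, div_lt_div_iff_of_pos_right (by positivity)] at h1 h2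
  have h1' : wordNumber (D.segment n) < m * 2 ^ k := by exact_mod_cast h1
  have h2' : m * 2 ^ k < wordNumber (D.segment n) + 1 := by exact_mod_cast h2
  omega

theorem IsDecimal.exists_rat (h : D.IsDecimal θ) (hp : D.IsPeriodic) : ∃ q : ℚ, θ = q := by
  obtain ⟨u, P, hP, hpre⟩ := hp
  have hlen : 1 ≤ P.length := List.length_pos_iff.2 hP
  have hpow : (2 : ℝ) ≤ 2 ^ P.length := by
    simpa using pow_le_pow_right₀ (one_le_two (α := ℝ)) hlen
  -- `x` is the decimal of `PPP⋯`, the solution of `x = 0.P + x / 2 ^ |P|`.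
  set x : ℝ := wordNumber P / (2 ^ P.length - 1) with hx
  have hfix : finiteDecimal P + x / 2 ^ P.length = x := by
    have : (2 : ℝ) ^ P.length - 1 ≠ 0 := by linarith
    rw [hx, finiteDecimal]
    field_simp
    ring
  have hrep (r : ℕ) : finiteDecimal (List.replicate r P).flatten =
      x - x * (1 / 2 ^ P.length) ^ r := by
    induction r with
    | zero => simp [finiteDecimal, wordNumber]
    | succ r ih =>
      rw [List.replicate_succ, List.flatten_cons, finiteDecimal_append, ih, pow_succ]
      linear_combination hfix
  have hlenrep (r : ℕ) : (List.replicate r P).flatten.length = r * P.length := by simp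
  have hsmall : Tendsto (fun r : ℕ => (1 / (2 : ℝ) ^ P.length) ^ r) atTop (𝓝 0) := by
    refine tendsto_pow_atTop_nhds_zero_of_lt_one (by positivity) ?_
    rw [div_lt_one (by positivity)]
    linarith
  have hlow : Tendsto (fun r : ℕ => finiteDecimal (u ++ (List.replicate r P).flatten)) atTop
      (𝓝 (finiteDecimal u + x / 2 ^ u.length)) := by
    simp only [finiteDecimal_append, hrep]
    simpa using ((hsmall.const_mul x).const_sub x |>.div_const (2 ^ u.length)).const_add
      (finiteDecimal u)
  have hupp : Tendsto (fun r : ℕ => finiteDecimalUpper (u ++ (List.replicate r P).flatten)) atTop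
      (𝓝 (finiteDecimal u + x / 2 ^ u.length)) := by
    have := hlow.add (hsmall.div_const (2 ^ u.length))
    simp only [zero_div, add_zero] at this
    refine this.congr fun r => ?_
    rw [finiteDecimalUpper, List.length_append, hlenrep, pow_add, mul_comm r, pow_mul, one_div_pow]
    field_simp
  have hθ : θ = finiteDecimal u + x / 2 ^ u.length := by
    refine le_antisymm (ge_of_tendsto' hupp fun r => ?_) (le_of_tendsto' hlow fun r => ?_)
    · obtain ⟨j, hj⟩ := hpre r
      exact (h.mem_Icc j).2.trans (finiteDecimalUpper_le_of_prefix hj)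
    · obtain ⟨j, hj⟩ := hpre r
      exact (finiteDecimal_le_of_prefix hj).trans (h.mem_Icc j).1
  refine ⟨wordNumber u / 2 ^ u.length + wordNumber P / (2 ^ P.length - 1) / 2 ^ u.length, ?_⟩
  rw [hθ, hx, finiteDecimal]
  push_cast
  rfl

end InfiniteDesign

/-! ### The design of a rational number -/

/-- The binary digits of `θ ∈ [0, 1)`, counted from `0`. -/
noncomputable def binaryDigit (θ : ℝ) (n : ℕ) : Bool := decide (1 / 2 ≤ doubling^[n] θ)

theorem two_mul_doubling_iterate (θ : ℝ) (n : ℕ) :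
    2 * doubling^[n] θ = (binaryDigit θ n).toNat + doubling^[n + 1] θ := by
  rw [Function.iterate_succ_apply', binaryDigit]
  generalize doubling^[n] θ = y
  unfold doubling
  split_ifs with h
  · rw [decide_eq_false (not_le.2 h)]
    simp
  · rw [decide_eq_true (not_lt.1 h)]
    simp

theorem two_pow_mul_eq_wordNumber_add (θ : ℝ) (n : ℕ) :
    2 ^ n * θ = wordNumber ((List.range n).map (binaryDigit θ)) + doubling^[n] θ := by
  induction n with
  | zero => simp [wordNumber]
  | succ n ih =>
    rw [List.range_succ, List.map_append, wordNumber_append]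
    have := two_mul_doubling_iterate θ n
    simp only [List.map_cons, List.map_nil, wordNumber, List.length_singleton, List.length_nil]
    push_cast
    linear_combination 2 * ih + this

theorem finiteDecimal_binaryDigits (θ : ℝ) (n : ℕ) :
    finiteDecimal ((List.range n).map (binaryDigit θ)) = θ - doubling^[n] θ / 2 ^ n := by
  have := two_pow_mul_eq_wordNumber_add θ n
  rw [finiteDecimal, List.length_map, List.length_range]
  field_simp
  linear_combination -this

theorem mem_dyadicSet_of_doubling_iterate_eq_zero {θ : ℝ} {n : ℕ}
    (h : doubling^[n] θ = 0) : θ ∈ dyadicSet := by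
  have h1 := two_pow_mul_eq_wordNumber_add θ n
  have h2 := wordNumber_lt ((List.range n).map (binaryDigit θ))
  rw [List.length_map, List.length_range] at h2
  refine ⟨n, _, h2, ?_⟩
  rw [eq_div_iff (by positivity)]
  linear_combination h1 + h

theorem eq_zero_of_two_pow_mul_le_one {x : ℝ} (h0 : 0 ≤ x) (h : ∀ k : ℕ, 2 ^ k * x ≤ 1) :
    x = 0 := by
  by_contra hne
  have hx : 0 < x := lt_of_le_of_ne h0 (Ne.symm hne)
  obtain ⟨k, hk⟩ := pow_unbounded_of_one_lt (1 / x) one_lt_two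
  rw [div_lt_iff₀ hx] at hk
  linarith [h k]

/-- A tail of zeros would force an iterate of the doubling map to be `0`, a tail of ones would force
one to be `1`. -/
theorem exists_binaryDigit_eq {θ : ℝ} (hθ : θ ∈ Ico (0 : ℝ) 1) (hd : θ ∉ dyadicSet)
    (b : Bool) (N : ℕ) : ∃ n, N ≤ n ∧ binaryDigit θ n = b := by
  by_contra! hc
  obtain ⟨h0, h1⟩ := doubling_iterate_mem hθ N
  cases b with
  | true =>
    refine hd (mem_dyadicSet_of_doubling_iterate_eq_zero (n := N)
      (eq_zero_of_two_pow_mul_le_one h0 fun k => ?_))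
    have : 2 ^ k * doubling^[N] θ = doubling^[N + k] θ := by
      induction k with
      | zero => simp
      | succ k ih =>
        have h2 := two_mul_doubling_iterate θ (N + k)
        rw [Bool.eq_false_iff.2 (hc (N + k) (by omega))] at h2
        simp only [Bool.toNat_false, Nat.cast_zero] at h2
        rw [pow_succ, ← add_assoc]
        linear_combination 2 * ih + h2
    exact this.le.trans (doubling_iterate_mem hθ _).2.le
  | false =>
    have h3 : 1 - doubling^[N] θ = 0 := by
      refine eq_zero_of_two_pow_mul_le_one (by linarith) fun k => ?_
      have : 2 ^ k * (1 - doubling^[N] θ) = 1 - doubling^[N + k] θ := by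
        induction k with
        | zero => simp
        | succ k ih =>
          have h2 := two_mul_doubling_iterate θ (N + k)
          rw [Bool.ne_false_iff.1 (hc (N + k) (by omega))] at h2
          simp only [Bool.toNat_true, Nat.cast_one] at h2
          rw [pow_succ, ← add_assoc]
          linear_combination 2 * ih - h2
      linarith [(doubling_iterate_mem hθ (N + k)).1]
    linarith

/-- A binary sequence in which both letters occur infinitely often is an infinite design. -/
theorem exists_infiniteDesign (d : ℕ → Bool) (hd : ∀ b N, ∃ n, N ≤ n ∧ d n = b) :
    ∃ (D : InfiniteDesign) (s : ℕ → ℕ), (∀ j, j ≤ s j) ∧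
      ∀ j, D.segment j = (List.range (s j)).map d := by
  have hnext (i N : ℕ) : ∃ M, N ≤ M ∧ d M = !decide (i % 2 = 0) ∧
      ∀ k, N ≤ k → k < M → d k = decide (i % 2 = 0) := by
    classical
    have h := hd (!decide (i % 2 = 0)) N
    refine ⟨Nat.find h, (Nat.find_spec h).1, (Nat.find_spec h).2, fun k hk hk' => ?_⟩
    have := Nat.find_min h hk'
    simpa [hk, Bool.eq_not] using this
  choose next hle hval hconst using hnext
  -- `t i` is the total length of the first `i` blocks.
  let t : ℕ → ℕ := fun i => Nat.rec 0 next i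
  have ht (i : ℕ) : t (i + 1) = next i (t i) := rfl
  have hmono (i : ℕ) : t i ≤ t (i + 1) := hle i (t i)
  have hpos (i : ℕ) (hi : 1 ≤ i) : 1 ≤ t (i + 1) - t i := by
    obtain ⟨i, rfl⟩ := Nat.exists_eq_add_of_le' hi
    have hne : t (i + 1 + 1) ≠ t (i + 1) := by
      intro he
      have h1 := hval i (t i)
      have h2 := hval (i + 1) (t (i + 1))
      rw [← ht] at h1 h2
      rw [he, h1] at h2
      rcases Nat.mod_two_eq_zero_or_one i with h | h <;> simp [h, Nat.add_mod] at h2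
    have := hmono (i + 1)
    omega
  let D : InfiniteDesign := ⟨fun i => t (i + 1) - t i, hpos⟩
  have hblocks (J : ℕ) : ((List.range J).flatMap fun i =>
      List.replicate (D.run i) (decide (i % 2 = 0))) = (List.range (t J)).map d := by
    induction J with
    | zero => rfl
    | succ J ih =>
      have e : t (J + 1) = t J + D.run J := by
        have := hmono J
        change t (J + 1) = t J + (t (J + 1) - t J)
        omega
      rw [List.range_succ, List.flatMap_append, ih, e, List.range_add, List.map_append,
        List.map_map]
      simp only [List.flatMap_cons, List.flatMap_nil, List.append_nil, List.append_cancel_left_eq]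
      symm
      rw [List.eq_replicate_iff]
      refine ⟨by simp, fun b hb => ?_⟩
      obtain ⟨k, hk, rfl⟩ := List.mem_map.1 hb
      rw [List.mem_range] at hk
      refine hconst J (t J) _ (Nat.le_add_right _ _) ?_
      rw [← ht, e]
      exact Nat.add_lt_add_left hk _
  refine ⟨D, fun j => t (2 * j + 1), fun j => ?_, fun j => hblocks _⟩
  have := D.le_length_segment j
  rwa [InfiniteDesign.segment, hblocks, List.length_map, List.length_range] at this

theorem flatten_replicate_of_periodic (d : ℕ → Bool) (m p : ℕ)
    (hp : ∀ i, m ≤ i → d (i + p) = d i) (r : ℕ) :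
    (List.range m).map d ++ (List.replicate r ((List.range p).map fun i => d (m + i))).flatten =
      (List.range (m + r * p)).map d := by
  have hshift (r i : ℕ) : d (m + r * p + i) = d (m + i) := by
    induction r with
    | zero => simp
    | succ r ih =>
      rw [← ih, ← hp (m + r * p + i) (by rw [add_assoc]; exact Nat.le_add_right _ _)]
      congr 1
      ring
  induction r with
  | zero => simp
  | succ r ih =>
    rw [List.replicate_succ', List.flatten_append, ← List.append_assoc, ih,
      show m + (r + 1) * p = m + r * p + p by ring, List.range_add (n := m + r * p),
      List.map_append, List.map_map]
    simp only [Function.comp_def, hshift, List.flatten_singleton]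

/-- The digits of `θ` are read off along its orbit under the doubling map, so they are periodic as
soon as the orbit repeats a point. -/
theorem isPeriodicDesignDecimal_of_rat {θ : ℝ} (hθ : θ ∈ Ico (0 : ℝ) 1) {q : ℚ} (hq : θ = q)
    (hd : θ ∉ dyadicSet) : IsPeriodicDesignDecimal θ := by
  obtain ⟨D, s, hs, hseg⟩ := exists_infiniteDesign (binaryDigit θ) (exists_binaryDigit_eq hθ hd)
  refine ⟨D, ?_, ?_⟩
  · obtain ⟨m, n, hmn, he⟩ := exists_doubling_iterate_eq_of_rat hθ hq
    obtain ⟨p, rfl⟩ := Nat.exists_eq_add_of_lt hmn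
    have hper (i : ℕ) (hi : m ≤ i) : binaryDigit θ (i + (p + 1)) = binaryDigit θ i := by
      obtain ⟨k, rfl⟩ := Nat.exists_eq_add_of_le' hi
      rw [binaryDigit, binaryDigit, add_assoc k m, ← add_assoc m,
        Function.iterate_add_apply _ k, Function.iterate_add_apply _ k, ← he]
    refine ⟨(List.range m).map (binaryDigit θ),
      (List.range (p + 1)).map fun i => binaryDigit θ (m + i), by simp, fun r => ?_⟩
    rw [flatten_replicate_of_periodic _ m (p + 1) hper]
    refine ⟨m + r * (p + 1), ?_⟩
    obtain ⟨k, hk⟩ := Nat.exists_eq_add_of_le (hs (m + r * (p + 1)))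
    rw [hseg, hk, List.range_add (n := m + r * (p + 1)), List.map_append]
    exact List.prefix_append _ _
  · have hsmall : Tendsto (fun j : ℕ => θ - (1 / 2 : ℝ) ^ j) atTop (𝓝 θ) := by
      simpa using (tendsto_pow_atTop_nhds_zero_of_lt_one (r := (1 / 2 : ℝ)) (by norm_num)
        (by norm_num)).const_sub θ
    refine tendsto_of_tendsto_of_tendsto_of_le_of_le hsmall tendsto_const_nhds
      (fun j => ?_) (fun j => ?_)
    · simp only [hseg, finiteDecimal_binaryDigits]
      have h1 := (doubling_iterate_mem hθ (s j)).2
      have h2 : doubling^[s j] θ / 2 ^ s j ≤ (1 / 2 : ℝ) ^ j := by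
        rw [one_div_pow]
        exact div_le_div₀ zero_le_one h1.le (by positivity)
          (pow_le_pow_right₀ one_le_two (hs j))
      linarith
    · simp only [hseg, finiteDecimal_binaryDigits]
      have h1 := (doubling_iterate_mem hθ (s j)).1
      have : 0 ≤ doubling^[s j] θ / 2 ^ s j := by positivity
      linarith

theorem isPeriodicDesignDecimal_iff {θ : ℝ} (hθ : θ ∈ Ico (0 : ℝ) 1) :
    IsPeriodicDesignDecimal θ ↔ (∃ q : ℚ, θ = (q : ℝ)) ∧ θ ∉ dyadicSet := by
  constructor
  · rintro ⟨D, hp, h⟩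
    exact ⟨h.exists_rat hp, h.notMem_dyadicSet⟩
  · rintro ⟨⟨q, hq⟩, hd⟩
    exact isPeriodicDesignDecimal_of_rat hθ hq hd

theorem theorem7p4 (θ : ℝ) (hθ : θ ∈ Set.Ico (0 : ℝ) 1) :
    (((∃ q : ℚ, assembly θ = (q : ℝ)) ↔ θ ∈ dyadicSet) ∧
      ((∃ q : ℚ, assembly θ = (q : ℝ)) ↔ IsFiniteDesignDecimal θ)) ∧
    ((IsQuadraticIrrational (assembly θ) ↔ (∃ q : ℚ, θ = (q : ℝ)) ∧ θ ∉ dyadicSet) ∧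
      (IsQuadraticIrrational (assembly θ) ↔ IsPeriodicDesignDecimal θ)) := by
  rw [isFiniteDesignDecimal_iff, isPeriodicDesignDecimal_iff hθ]
  have h1 := assembly_rational_iff hθ
  have h2 := isQuadraticIrrational_assembly_iff hθ
  exact ⟨⟨h1, h1⟩, h2, h2⟩
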